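/- For a polynomial or power series $f(z)=\sum_k a_k z^k$ with nonzero complex coefficients, let $q_k(f)=\dfrac{a_{k-1}^2}{a_{k-2}a_k}$, $k\ge 2$, be its second quotients. For an integer $n\ge 1$ let $b_{2n}$ be the unique positive root of the equation $1-2\sum_{k=1}^{n}x^{-k^2/2}=0$, and let $b_\infty$ be the unique positive root of the equation $1-2\sum_{k=1}^{\infty}x^{-k^2/2}=0$. (i) Let $n\ge 1$ be an integer and let $P(z)=\sum_{k=0}^{2n}a_kz^k$ be a polynomial with $a_k\in\mathbb{C}\setminus\{0\}$ for all $0\le k\le 2n$. If $|q_k(P)|>b_{2n}$ for all $k=2,3,\dots,2n$, then all the zeros of $P$ are simple, and the moduli of the zeros of $P$ are pairwise different. (ii) Let $n\ge 1$ be an integer and let $P(z)=\sum_{k=0}^{2n+1}a_kz^k$ be a polynomial with $a_k\in\mathbb{C}\setminus\{0\}$ for all $0\le k\le 2n+1$. If $|q_k(P)|\ge b_{2n+2}$ for all $k=2,3,\dots,2n+1$, then all the zeros of $P$ are simple, and the moduli of the zeros of $P$ are pairwise different. (iii) Let $f(z)=\sum_{k=0}^{\infty}a_kz^k$ be an entire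 function with $a_k\in\mathbb{C}\setminus\{0\}$ for all $k\ge 0$. If $|q_k(f)|\ge b_\infty$ for all $k\ge 2$, then all the zeros of $f$ are simple, and the moduli of the zeros of $f$ are pairwise different. -/

import Mathlib

/-- The second quotient `q_k = a_{k-1}^2 / (a_{k-2} a_k)` of a coefficient sequence, for `k ≥ 2`. -/
noncomputable def secondQuotient (a : ℕ → ℂ) (k : ℕ) : ℂ :=
  a (k - 1) ^ 2 / (a (k - 2) * a k)

/-- `x` is a positive root of `1 - 2 ∑_{k=1}^n x^{-k^2/2} = 0`. -/
def IsEvenRoot (n : ℕ) (x : ℝ) : Prop :=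
  0 < x ∧ 1 - 2 * ∑ k ∈ Finset.Icc 1 n, x ^ (-(k : ℝ) ^ 2 / 2) = 0

/-- `x` is a positive root of `1 - 2 ∑_{k=1}^∞ x^{-k^2/2} = 0`, the series being convergent.
The summation index is shifted: the `k`-th summand below is the one for `k + 1`. -/
def IsInftyRoot (x : ℝ) : Prop :=
  0 < x ∧ Summable (fun k : ℕ => x ^ (-((k : ℝ) + 1) ^ 2 / 2)) ∧
    1 - 2 * ∑' k : ℕ, x ^ (-((k : ℝ) + 1) ^ 2 / 2) = 0

theorem rpow_four_half : (4 : ℝ) ^ (-(1 : ℝ) ^ 2 / 2) = 1 / 2 := by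
  rw [show (4 : ℝ) = 2 ^ (2 : ℝ) by norm_num, ← Real.rpow_mul (by norm_num)]
  norm_num [Real.rpow_neg]

theorem term_le_geometric (c x : ℝ) (hc : 1 < c) (hx : c ^ 2 ≤ x) (k : ℕ) :
    x ^ (-((k : ℝ) + 1) ^ 2 / 2) ≤ c⁻¹ * c⁻¹ ^ k := by
  have h0 : 0 < c := by linarith
  calc x ^ (-((k : ℝ) + 1) ^ 2 / 2)
      ≤ (c ^ 2) ^ (-((k : ℝ) + 1) ^ 2 / 2) :=
        Real.rpow_le_rpow_of_nonpos (by positivity) hx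
          (by have := sq_nonneg ((k : ℝ) + 1); linarith)
    _ = c ^ (-((k : ℝ) + 1) ^ 2) := by
        rw [← Real.rpow_natCast c 2, ← Real.rpow_mul h0.le]
        congr 1; push_cast; ring
    _ ≤ c ^ (-((k + 1 : ℕ) : ℝ)) := by
        apply Real.rpow_le_rpow_of_exponent_le hc.le
        have : (0 : ℝ) ≤ k := Nat.cast_nonneg k
        push_cast; nlinarith
    _ = c⁻¹ * c⁻¹ ^ k := by
        rw [Real.rpow_neg h0.le, Real.rpow_natCast, pow_succ, mul_inv, inv_pow, mul_comm]

theorem term_lt (x y : ℝ) (hx : 0 < x) (hxy : x < y) (k : ℕ) :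
    y ^ (-((k : ℝ) + 1) ^ 2 / 2) < x ^ (-((k : ℝ) + 1) ^ 2 / 2) :=
  Real.rpow_lt_rpow_of_neg hx hxy (by
    have : (0 : ℝ) < ((k : ℝ) + 1) ^ 2 := by positivity
    linarith)

theorem summable_geometric_bound (c : ℝ) (hc : 1 < c) :
    Summable (fun k : ℕ => c⁻¹ * c⁻¹ ^ k) :=
  (summable_geometric_of_lt_one (by positivity) (inv_lt_one_of_one_lt₀ hc)).mul_left _

theorem summable_terms (x : ℝ) (hx : 4 ≤ x) :
    Summable (fun k : ℕ => x ^ (-((k : ℝ) + 1) ^ 2 / 2)) :=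
  Summable.of_nonneg_of_le (fun k => Real.rpow_nonneg (by linarith) _)
    (fun k => term_le_geometric 2 x (by norm_num) (by linarith) k)
    (summable_geometric_bound 2 (by norm_num))

theorem tsum_nine_le : ∑' k : ℕ, (9 : ℝ) ^ (-((k : ℝ) + 1) ^ 2 / 2) ≤ 1 / 2 := by
  refine ((summable_terms 9 (by norm_num)).tsum_le_tsum
    (fun k => term_le_geometric 3 9 (by norm_num) (by norm_num) k)
    (summable_geometric_bound 3 (by norm_num))).trans ?_
  rw [tsum_mul_left, tsum_geometric_of_lt_one (by norm_num) (by norm_num)]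
  norm_num

theorem sum_Icc_shift (n : ℕ) (x : ℝ) :
    ∑ k ∈ Finset.Icc 1 n, x ^ (-(k : ℝ) ^ 2 / 2) =
      ∑ k ∈ Finset.range n, x ^ (-((k : ℝ) + 1) ^ 2 / 2) := by
  rw [Finset.range_eq_Ico, ← Finset.Ico_add_one_right_eq_Icc,
    ← Finset.sum_Ico_add' (fun k : ℕ => x ^ (-(k : ℝ) ^ 2 / 2)) 0 n 1]
  simp

theorem existsUnique_isEvenRoot (n : ℕ) (hn : 1 ≤ n) : ∃! x : ℝ, IsEvenRoot n x := by
  unfold IsEvenRoot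
  simp only [sum_Icc_shift]
  have hcont : ContinuousOn
      (fun x : ℝ => 1 - 2 * ∑ k ∈ Finset.range n, x ^ (-((k : ℝ) + 1) ^ 2 / 2))
      (Set.Icc 4 9) := by
    refine continuousOn_const.sub (continuousOn_const.mul (continuousOn_finsetSum _ ?_))
    intro k _
    exact continuousOn_id.rpow_const fun x hx => Or.inl (by
      have := hx.1; simp only [id]; linarith)
  have h4 : 1 / 2 ≤ ∑ k ∈ Finset.range n, (4 : ℝ) ^ (-((k : ℝ) + 1) ^ 2 / 2) := by
    have := Finset.single_le_sum
      (f := fun k : ℕ => (4 : ℝ) ^ (-((k : ℝ) + 1) ^ 2 / 2))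
      (fun k _ => Real.rpow_nonneg (by norm_num) _) (Finset.mem_range.2 hn)
    simpa [rpow_four_half] using rpow_four_half.symm.le.trans (by simpa using this)
  have h9 : ∑ k ∈ Finset.range n, (9 : ℝ) ^ (-((k : ℝ) + 1) ^ 2 / 2) ≤ 1 / 2 :=
    ((summable_terms 9 (by norm_num)).sum_le_tsum _
      (fun k _ => Real.rpow_nonneg (by norm_num) _)).trans tsum_nine_le
  obtain ⟨x, hx, hx0⟩ := intermediate_value_Icc (by norm_num) hcont
    (show (0 : ℝ) ∈ Set.Icc _ _ from ⟨by linarith, by linarith⟩)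
  have key : ∀ x y : ℝ, 0 < x → x < y →
      ∑ k ∈ Finset.range n, y ^ (-((k : ℝ) + 1) ^ 2 / 2) <
        ∑ k ∈ Finset.range n, x ^ (-((k : ℝ) + 1) ^ 2 / 2) := fun x y hx hxy =>
    Finset.sum_lt_sum_of_nonempty ⟨0, Finset.mem_range.2 hn⟩
      (fun k _ => term_lt x y hx hxy k)
  refine ⟨x, ⟨by have := hx.1; linarith, hx0⟩, ?_⟩
  rintro y ⟨hy, hy0⟩
  simp only at hx0
  rcases lt_trichotomy x y with h | h | h
  · have := key x y (by have := hx.1; linarith) h; linarith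
  · exact h.symm
  · have := key y x hy h; linarith

theorem existsUnique_isInftyRoot : ∃! x : ℝ, IsInftyRoot x := by
  have hcont : ContinuousOn
      (fun x : ℝ => 1 - 2 * ∑' k : ℕ, x ^ (-((k : ℝ) + 1) ^ 2 / 2)) (Set.Icc 4 9) := by
    refine continuousOn_const.sub (continuousOn_const.mul
      (continuousOn_tsum ?_ (summable_geometric_bound 2 (by norm_num)) ?_))
    · intro k
      exact continuousOn_id.rpow_const fun x hx => Or.inl (by
        have := hx.1; simp only [id]; linarith)
    · intro k x hx
      rw [Real.norm_of_nonneg (Real.rpow_nonneg (by have := hx.1; linarith) _)]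
      exact term_le_geometric 2 x (by norm_num) (by have := hx.1; linarith) k
  have h4 : 1 / 2 ≤ ∑' k : ℕ, (4 : ℝ) ^ (-((k : ℝ) + 1) ^ 2 / 2) := by
    have := (summable_terms 4 le_rfl).le_tsum 0
      (fun k _ => Real.rpow_nonneg (by norm_num) _)
    exact rpow_four_half.symm.le.trans (by simpa using this)
  have h9 := tsum_nine_le
  obtain ⟨x, hx, hx0⟩ := intermediate_value_Icc (by norm_num) hcont
    (show (0 : ℝ) ∈ Set.Icc _ _ from ⟨by linarith, by linarith⟩)
  simp only at hx0
  have key : ∀ x y : ℝ, IsInftyRoot x → IsInftyRoot y → ¬ x < y := by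
    rintro x y ⟨hx, hxs, hx0⟩ ⟨-, hys, hy0⟩ hxy
    have := hys.tsum_lt_tsum (fun k => (term_lt x y hx hxy k).le) (term_lt x y hx hxy 0) hxs
    linarith
  have hroot : IsInftyRoot x :=
    ⟨by have := hx.1; linarith, summable_terms x hx.1, hx0⟩
  exact ⟨x, hroot, fun y hy => le_antisymm (not_lt.1 (key x y hroot hy))
    (not_lt.1 (key y x hy hroot))⟩

/-- The constant `b_{2n}`, `n ≥ 1`: the unique positive root of
`1 - 2 ∑_{k=1}^n x^{-k^2/2} = 0`. -/
noncomputable def bEven (n : ℕ) (hn : 1 ≤ n) : ℝ :=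
  Classical.choose (existsUnique_isEvenRoot n hn).exists

/-- The constant `b_∞`: the unique positive root of `1 - 2 ∑_{k=1}^∞ x^{-k^2/2} = 0`. -/
noncomputable def bInfty : ℝ :=
  Classical.choose existsUnique_isInftyRoot.exists

theorem bEven_spec (n : ℕ) (hn : 1 ≤ n) : IsEvenRoot n (bEven n hn) :=
  Classical.choose_spec (existsUnique_isEvenRoot n hn).exists

theorem bInfty_spec : IsInftyRoot bInfty :=
  Classical.choose_spec existsUnique_isInftyRoot.exists

/-!
Put `s = c ^ (-1/2)`, where `c` is a lower bound for the moduli of the second quotients. At every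
radius where the term `a_j z ^ j` exceeds its two neighbours in modulus by a factor `s⁻¹`, the lower
bound on the second quotients makes the terms `a_{j ± m} z ^ (j ± m)` at most `s ^ (m ^ 2)` times as
large, so the other terms together are at most `θ_j + θ_d` times as large, where
`θ_n = s + s ^ 4 + ⋯ + s ^ (n ^ 2)` and `d` is the number of terms above index `j`. The constants
`b_{2n}` and `b_∞` make this factor less than one, as `n ↦ θ_n` is concave. Hence no zero has such a
modulus. The remaining radii form open intervals between a radius at which some `j` dominates and
one at which `j + 1` does; by Rouché's theorem the discs of these radii contain `j` and `j + 1`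
zeros, so that the annulus between them contains exactly one.
-/

section ArgumentPrinciple

open Complex Function Metric MeromorphicOn Real Topology

/-- The number of zeros of an analytic function `f` in the closed disc of radius `R` about `c`,
counted with multiplicity; a function with poles has them counted negatively. -/
noncomputable def zeroCount (f : ℂ → ℂ) (c : ℂ) (R : ℝ) : ℤ :=
  ∑ᶠ u, divisor f (closedBall c R) u

variable {f g : ℂ → ℂ} {c : ℂ} {r R : ℝ}

theorem finite_support_divisor_closedBall (f : ℂ → ℂ) (c : ℂ) (R : ℝ) :
    (divisor f (closedBall c R)).support.Finite :=
  (divisor f (closedBall c R)).finiteSupport (isCompact_closedBall c R)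

theorem divisor_eq_zero_of_ne_zero {𝕜 : Type*} [NontriviallyNormedField 𝕜] {f : 𝕜 → 𝕜}
    {U : Set 𝕜} {z : 𝕜} (hf : AnalyticAt 𝕜 f z) (hz : f z ≠ 0) :
    divisor f U z = 0 := by
  rw [divisor_def]
  split_ifs
  · rw [hf.meromorphicOrderAt_eq, hf.analyticOrderAt_eq_zero.2 hz]
    rfl
  · rfl

theorem logDeriv_finprod_sub_zpow {𝕜 : Type*} [NontriviallyNormedField 𝕜] {d : 𝕜 → ℤ}
    (hd : d.support.Finite) {z : 𝕜} (hz : d z = 0) :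
    logDeriv (∏ᶠ u, (· - u) ^ d u) z = ∑ᶠ u, d u * (z - u)⁻¹ := by
  have hne : ∀ u ∈ hd.toFinset, z - u ≠ 0 := fun u hu h =>
    (hd.mem_toFinset.1 hu) (sub_eq_zero.1 h ▸ hz)
  rw [finprod_eq_prod_of_mulSupport_subset (s := hd.toFinset) _
      (by simp [FactorizedRational.mulSupport]),
    finsum_eq_sum_of_support_subset (s := hd.toFinset) _
      (fun u hu => hd.mem_toFinset.2 fun h => hu (by simp [h])),
    Finset.prod_fn, logDeriv_prod]
  · refine Finset.sum_congr rfl fun u _ => ?_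
    rw [Pi.pow_def, logDeriv_fun_zpow (by fun_prop)]
    simp [logDeriv_apply]
  · exact fun u hu => zpow_ne_zero _ (hne u hu)
  · exact fun u hu => (DifferentiableAt.zpow (by fun_prop) (Or.inl (hne u hu)))

theorem meromorphicOrderAt_ne_top_of_ne_zero (hf : AnalyticOnNhd ℂ f (closedBall c R)) {w : ℂ}
    (hw : w ∈ closedBall c R) (hfw : f w ≠ 0) {z : ℂ} (hz : z ∈ closedBall c R) :
    meromorphicOrderAt f z ≠ ⊤ :=
  hf.meromorphicOn.meromorphicOrderAt_ne_top_of_isPreconnected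
    (convex_closedBall c R).isPreconnected hw hz
    (by simp [(hf w hw).meromorphicOrderAt_eq, (hf w hw).analyticOrderAt_eq_zero.2 hfw])

theorem exists_eventuallyEq_finprod_mul (hR : 0 < R) (hf : AnalyticOnNhd ℂ f (closedBall c R))
    {w : ℂ} (hw : w ∈ closedBall c R) (hfw : f w ≠ 0) :
    ∃ g, AnalyticOnNhd ℂ g (closedBall c R) ∧ (∀ z ∈ closedBall c R, g z ≠ 0) ∧
      ∀ z ∈ closedBall c R,
        f =ᶠ[𝓝 z] (∏ᶠ u, (· - u) ^ divisor f (closedBall c R) u) * g := by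
  obtain ⟨g, hg, hg0, hfg⟩ := hf.meromorphicOn.extract_zeros_poles
    (fun u => meromorphicOrderAt_ne_top_of_ne_zero hf hw hfw u.2)
    (finite_support_divisor_closedBall f c R)
  refine ⟨g, hg, fun z hz => hg0 ⟨z, hz⟩, fun z hz => ?_⟩
  have hprod := (FactorizedRational.analyticAt (hf.divisor_nonneg z)).mul (hg z hz)
  have hperf : Preperfect (closedBall c R) :=
    (convex_closedBall c R).isPreconnected.preperfect_of_nontrivial
      ⟨c, mem_closedBall_self hR.le, c + R, by simp [abs_of_pos hR], by simp [hR.ne']⟩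
  exact ((hf z hz).continuousAt.eventuallyEq_nhds_iff_eventuallyEq_nhdsNE hprod.continuousAt).1
    ((hf z hz).meromorphicAt.eventuallyEq_nhdsNE_of_eventuallyEq_codiscreteWithin_preperfect
      hprod.meromorphicAt hz hperf hfg)

theorem circleIntegrable_logDeriv (hR : 0 ≤ R) (hf : AnalyticOnNhd ℂ f (sphere c R))
    (h0 : ∀ z ∈ sphere c R, f z ≠ 0) : CircleIntegrable (logDeriv f) c R :=
  (hf.deriv.continuousOn.div hf.continuousOn h0).circleIntegrable hR

theorem circleIntegral_logDeriv_eq_zero (hR : 0 ≤ R) (hf : AnalyticOnNhd ℂ f (closedBall c R))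
    (h0 : ∀ z ∈ closedBall c R, f z ≠ 0) : (∮ z in C(c, R), logDeriv f z) = 0 := by
  have hlog : AnalyticOnNhd ℂ (logDeriv f) (closedBall c R) := hf.deriv.div hf h0
  exact circleIntegral_eq_zero_of_differentiable_on_off_countable hR Set.countable_empty
    hlog.continuousOn fun z hz => (hlog z (ball_subset_closedBall hz.1)).differentiableAt

theorem circleIntegral_finsum_mul_sub_inv {d : ℂ → ℤ} (hd : d.support.Finite)
    (hball : d.support ⊆ ball c R) :
    CircleIntegrable (fun z => ∑ᶠ u, (d u : ℂ) * (z - u)⁻¹) c R ∧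
      (∮ z in C(c, R), ∑ᶠ u, (d u : ℂ) * (z - u)⁻¹) = 2 * π * I * ↑(∑ᶠ u, d u) := by
  have hsum : ∀ z : ℂ, ∑ᶠ u, (d u : ℂ) * (z - u)⁻¹ =
      ∑ u ∈ hd.toFinset, (d u : ℂ) * (z - u)⁻¹ := fun z =>
    finsum_eq_sum_of_support_subset _ fun u hu => hd.mem_toFinset.2 fun h => hu (by simp [h])
  have hint : ∀ u ∈ hd.toFinset, CircleIntegrable (fun z => (d u : ℂ) * (z - u)⁻¹) c R := by
    intro u hu
    have hu : u ∈ ball c R := hball (hd.mem_toFinset.1 hu)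
    refine IntervalIntegrable.const_mul (circleIntegrable_sub_inv_iff.2 (Or.inr fun hs => ?_)) _
    rw [mem_sphere, abs_of_pos (pos_of_mem_ball hu)] at hs
    exact hs.not_lt (mem_ball.1 hu)
  simp only [hsum]
  refine ⟨by simpa only [Finset.sum_fn] using CircleIntegrable.sum _ hint, ?_⟩
  rw [circleIntegral.integral_fun_sum hint, finsum_eq_sum_of_support_subset (s := hd.toFinset) _
    (by simp), Int.cast_sum, Finset.mul_sum]
  refine Finset.sum_congr rfl fun u hu => ?_
  rw [circleIntegral.integral_const_mul,
    circleIntegral.integral_sub_inv_of_mem_ball (hball (hd.mem_toFinset.1 hu)), mul_comm]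

theorem support_divisor_subset_ball (hf : AnalyticOnNhd ℂ f (closedBall c R))
    (h0 : ∀ z ∈ sphere c R, f z ≠ 0) :
    (divisor f (closedBall c R) : ℂ → ℤ).support ⊆ ball c R := by
  intro u hu
  have huR := (divisor f (closedBall c R)).supportWithinDomain hu
  refine lt_of_le_of_ne (mem_closedBall.1 huR) fun h => hu ?_
  exact divisor_eq_zero_of_ne_zero (hf u huR) (h0 u h)

theorem circleIntegral_logDeriv (hR : 0 < R) (hf : AnalyticOnNhd ℂ f (closedBall c R))
    (h0 : ∀ z ∈ sphere c R, f z ≠ 0) :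
    (∮ z in C(c, R), logDeriv f z) = 2 * π * I * zeroCount f c R := by
  have hsph : sphere c R ⊆ closedBall c R := sphere_subset_closedBall
  obtain ⟨w, hw⟩ := NormedSpace.sphere_nonempty (x := c) |>.2 hR.le
  obtain ⟨g, hg, hg0, hfg⟩ := exists_eventuallyEq_finprod_mul hR hf (hsph hw) (h0 w hw)
  have hfin := finite_support_divisor_closedBall f c R
  have hlog : Set.EqOn (logDeriv f)
      (fun z => ∑ᶠ u, divisor f (closedBall c R) u * (z - u)⁻¹ + logDeriv g z) (sphere c R) := by
    intro z hz
    have hdz := divisor_eq_zero_of_ne_zero (U := closedBall c R) (hf z (hsph hz)) (h0 z hz)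
    dsimp only
    rw [(logDeriv_congr_nhds (hfg z (hsph hz))).eq_of_nhds, ← logDeriv_finprod_sub_zpow hfin hdz]
    exact logDeriv_mul z (FactorizedRational.ne_zero hdz) (hg0 z (hsph hz))
      (FactorizedRational.analyticAt hdz.ge).differentiableAt (hg z (hsph hz)).differentiableAt
  obtain ⟨hint, hval⟩ :=
    circleIntegral_finsum_mul_sub_inv hfin (support_divisor_subset_ball hf h0)
  rw [circleIntegral.integral_congr hR.le hlog, circleIntegral.integral_add hint
    (circleIntegrable_logDeriv hR.le (hg.mono hsph) fun z hz => hg0 z (hsph hz)), hval,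
    circleIntegral_logDeriv_eq_zero hR.le hg hg0, add_zero, zeroCount]

theorem ne_zero_of_norm_sub_lt {x y : ℂ} (h : ‖x - y‖ < ‖y‖) : x ≠ 0 := by
  rintro rfl
  simp at h

theorem circleIntegral_logDeriv_eq_of_norm_sub_lt (hR : 0 ≤ R)
    (hf : AnalyticOnNhd ℂ f (sphere c R)) (hg : AnalyticOnNhd ℂ g (sphere c R))
    (hfg : ∀ z ∈ sphere c R, ‖f z - g z‖ < ‖g z‖) :
    (∮ z in C(c, R), logDeriv f z) = ∮ z in C(c, R), logDeriv g z := by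
  have hf0 : ∀ z ∈ sphere c R, f z ≠ 0 := fun z hz => ne_zero_of_norm_sub_lt (hfg z hz)
  have hg0 : ∀ z ∈ sphere c R, g z ≠ 0 := fun z hz =>
    norm_pos_iff.1 ((norm_nonneg _).trans_lt (hfg z hz))
  -- `f / g` stays in the disc `|w - 1| < 1`, where the principal logarithm is a primitive.
  have hslit : ∀ z ∈ sphere c R, f z / g z ∈ slitPlane := by
    intro z hz
    rw [← add_sub_cancel 1 (f z / g z)]
    apply mem_slitPlane_of_norm_lt_one
    rw [div_sub_one (hg0 z hz), norm_div, div_lt_one (norm_pos_iff.2 (hg0 z hz))]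
    exact hfg z hz
  rw [← sub_eq_zero, ← circleIntegral.integral_sub (circleIntegrable_logDeriv hR hf hf0)
    (circleIntegrable_logDeriv hR hg hg0)]
  refine circleIntegral.integral_eq_zero_of_hasDerivWithinAt hR
    (f := fun z => log (f z / g z)) fun z hz => HasDerivAt.hasDerivWithinAt ?_
  rw [← logDeriv_div z (hf0 z hz) (hg0 z hz) (hf z hz).differentiableAt
    (hg z hz).differentiableAt]
  exact ((hf z hz).differentiableAt.fun_div (hg z hz).differentiableAt
    (hg0 z hz)).hasDerivAt.clog (hslit z hz)

theorem zeroCount_eq_of_norm_sub_lt (hR : 0 < R) (hf : AnalyticOnNhd ℂ f (closedBall c R))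
    (hg : AnalyticOnNhd ℂ g (closedBall c R))
    (hfg : ∀ z ∈ sphere c R, ‖f z - g z‖ < ‖g z‖) : zeroCount f c R = zeroCount g c R := by
  have hsph : sphere c R ⊆ closedBall c R := sphere_subset_closedBall
  have h := circleIntegral_logDeriv_eq_of_norm_sub_lt hR.le (hf.mono hsph) (hg.mono hsph) hfg
  rw [circleIntegral_logDeriv hR hf fun z hz => ne_zero_of_norm_sub_lt (hfg z hz),
    circleIntegral_logDeriv hR hg fun z hz =>
      norm_pos_iff.1 ((norm_nonneg _).trans_lt (hfg z hz))] at h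
  exact_mod_cast mul_left_cancel₀ two_pi_I_ne_zero h

theorem zeroCount_const_mul_sub_pow (hR : 0 < R) {α : ℂ} (hα : α ≠ 0) (j : ℕ) :
    zeroCount (fun z => α * (z - c) ^ j) c R = j := by
  have h := circleIntegral_logDeriv (f := fun z => α * (z - c) ^ j) (c := c) hR
    (fun z _ => by fun_prop) fun z hz =>
      mul_ne_zero hα (pow_ne_zero _ (sub_ne_zero.2 (ne_of_mem_sphere hz hR.ne')))
  have hlog : ∀ z, logDeriv (fun z => α * (z - c) ^ j) z = j * (z - c)⁻¹ := fun z => by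
    rw [logDeriv_const_mul z α hα, logDeriv_fun_pow (by fun_prop)]
    simp [logDeriv_apply]
  simp only [hlog] at h
  rw [circleIntegral.integral_const_mul,
    circleIntegral.integral_sub_inv_of_mem_ball (mem_ball_self hR), mul_comm] at h
  exact_mod_cast (mul_left_cancel₀ two_pi_I_ne_zero h).symm

theorem one_le_divisor (hf : AnalyticOnNhd ℂ f (closedBall c R)) {w : ℂ}
    (hw : w ∈ closedBall c R) (hfw : f w ≠ 0) {z : ℂ} (hz : z ∈ closedBall c R) (hfz : f z = 0) :
    1 ≤ divisor f (closedBall c R) z := by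
  have htop := meromorphicOrderAt_ne_top_of_ne_zero hf hw hfw hz
  have hne : meromorphicOrderAt f z ≠ 0 := by
    simpa [(hf z hz).meromorphicOrderAt_eq] using (hf z hz).analyticOrderAt_ne_zero.2 hfz
  have hne' : divisor f (closedBall c R) z ≠ 0 := by
    rw [divisor_apply hf.meromorphicOn hz, ne_eq, WithTop.untop₀_eq_zero]
    exact not_or_intro hne htop
  exact Int.add_one_le_iff.2 ((hf.divisor_nonneg z).lt_of_ne hne'.symm)

theorem sum_le_finsum {α : Type*} {d : α → ℤ} (hd : d.support.Finite) (h0 : ∀ x, 0 ≤ d x)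
    (s : Finset α) : ∑ x ∈ s, d x ≤ ∑ᶠ x, d x := by
  classical
  rw [finsum_eq_sum_of_support_subset (s := s ∪ hd.toFinset) _ (by simp)]
  exact Finset.sum_le_sum_of_subset_of_nonneg Finset.subset_union_left fun x _ _ => h0 x

theorem sum_divisor_add_zeroCount_le (hrR : r ≤ R) (hf : AnalyticOnNhd ℂ f (closedBall c R))
    {s : Finset ℂ} (hs : ∀ z ∈ s, z ∉ closedBall c r) :
    ∑ z ∈ s, divisor f (closedBall c R) z + zeroCount f c r ≤ zeroCount f c R := by
  classical
  have hsub : closedBall c r ⊆ closedBall c R := closedBall_subset_closedBall hrR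
  have hr : ∀ z ∉ closedBall c r, divisor f (closedBall c r) z = 0 := fun z hz =>
    Function.locallyFinsuppWithin.apply_eq_zero_of_notMem _ hz
  have hle : ∀ z, divisor f (closedBall c r) z ≤ divisor f (closedBall c R) z := by
    intro z
    by_cases hz : z ∈ closedBall c r
    · rw [divisor_apply (hf.mono hsub).meromorphicOn hz, divisor_apply hf.meromorphicOn (hsub hz)]
    · rw [hr z hz]
      exact hf.divisor_nonneg z
  have hfinr := finite_support_divisor_closedBall f c r
  have hfinR := finite_support_divisor_closedBall f c R
  rw [← le_sub_iff_add_le, zeroCount, zeroCount, ← finsum_sub_distrib hfinR hfinr]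
  calc ∑ z ∈ s, divisor f (closedBall c R) z
      = ∑ z ∈ s, (divisor f (closedBall c R) z - divisor f (closedBall c r) z) :=
        Finset.sum_congr rfl fun z hz => by rw [hr z (hs z hz), sub_zero]
    _ ≤ ∑ᶠ z, (divisor f (closedBall c R) z - divisor f (closedBall c r) z) :=
        sum_le_finsum ((hfinR.union hfinr).subset (support_sub _ _))
          (fun z => sub_nonneg.2 (hle z)) s

theorem analyticOrderAt_eq_one_of_zeroCount_eq_add_one (hrR : r ≤ R)
    (hf : AnalyticOnNhd ℂ f (closedBall c R)) (hcount : zeroCount f c R = zeroCount f c r + 1)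
    {w : ℂ} (hw : w ∈ closedBall c R) (hfw : f w ≠ 0)
    {z : ℂ} (hz : z ∈ closedBall c R \ closedBall c r) (hfz : f z = 0) :
    analyticOrderAt f z = 1 := by
  have hle := sum_divisor_add_zeroCount_le hrR hf (s := {z}) (by simpa using hz.2)
  have hge := one_le_divisor hf hw hfw hz.1 hfz
  rw [Finset.sum_singleton, hcount] at hle
  have h1 : divisor f (closedBall c R) z = 1 := by omega
  rw [hf.divisor_apply hz.1] at h1
  cases h : analyticOrderAt f z with
  | top => simp [h] at h1
  | coe n =>
    rw [h, ENat.map_natCast, WithTop.untop₀_coe] at h1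
    exact_mod_cast h1

theorem eq_of_zeroCount_eq_add_one (hrR : r ≤ R)
    (hf : AnalyticOnNhd ℂ f (closedBall c R)) (hcount : zeroCount f c R = zeroCount f c r + 1)
    {w : ℂ} (hw : w ∈ closedBall c R) (hfw : f w ≠ 0)
    {z₁ z₂ : ℂ} (hz₁ : z₁ ∈ closedBall c R \ closedBall c r) (hfz₁ : f z₁ = 0)
    (hz₂ : z₂ ∈ closedBall c R \ closedBall c r) (hfz₂ : f z₂ = 0) : z₁ = z₂ := by
  by_contra hne
  have hle := sum_divisor_add_zeroCount_le hrR hf (s := {z₁, z₂})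
    (by simp [hz₁.2, hz₂.2, -mem_closedBall])
  have h₁ := one_le_divisor hf hw hfw hz₁.1 hfz₁
  have h₂ := one_le_divisor hf hw hfw hz₂.1 hfz₂
  rw [Finset.sum_pair hne, hcount] at hle
  omega

end ArgumentPrinciple

section StronglyLogConcave

/-- The partial theta sum `∑_{m=1}^n s ^ (m ^ 2)`. -/
noncomputable def thetaSum (s : ℝ) (n : ℕ) : ℝ :=
  ∑ m ∈ Finset.range n, s ^ ((m + 1) ^ 2)

variable {s : ℝ}

theorem thetaSum_succ (s : ℝ) (n : ℕ) :
    thetaSum s (n + 1) = thetaSum s n + s ^ ((n + 1) ^ 2) :=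
  Finset.sum_range_succ _ _

theorem thetaSum_lt_succ (hs : 0 < s) (n : ℕ) : thetaSum s n < thetaSum s (n + 1) := by
  rw [thetaSum_succ]
  exact lt_add_of_pos_right _ (by positivity)

theorem thetaSum_mono (hs : 0 < s) : Monotone (thetaSum s) :=
  monotone_nat_of_le_succ fun n => (thetaSum_lt_succ hs n).le

theorem le_thetaSum (hs : 0 < s) {n : ℕ} (hn : 1 ≤ n) : s ≤ thetaSum s n := by
  simpa [thetaSum] using thetaSum_mono hs hn

theorem thetaSum_add_thetaSum_add_two_mul_le (hs : 0 < s) (hs1 : s ≤ 1) (k d : ℕ) :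
    thetaSum s k + thetaSum s (k + 2 * d) ≤ 2 * thetaSum s (k + d) := by
  induction d generalizing k with
  | zero => simp [two_mul]
  | succ d ih =>
    have hinner := ih (k + 1)
    have houter : s ^ ((k + 1 + 2 * d + 1) ^ 2) ≤ s ^ ((k + 1) ^ 2) :=
      pow_le_pow_of_le_one hs.le hs1 (Nat.pow_le_pow_left (by omega) 2)
    rw [thetaSum_succ] at hinner
    rw [show k + 2 * (d + 1) = k + 1 + 2 * d + 1 by ring, thetaSum_succ,
      show k + (d + 1) = k + 1 + d by ring]
    linarith

theorem thetaSum_add_thetaSum_le (hs : 0 < s) (hs1 : s ≤ 1) {n i j : ℕ}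
    (h : i + j = 2 * n) : thetaSum s i + thetaSum s j ≤ 2 * thetaSum s n := by
  wlog hij : i ≤ j generalizing i j
  · rw [add_comm]
    exact this (by omega) (by omega)
  obtain ⟨d, rfl⟩ := Nat.exists_eq_add_of_le (show i ≤ n by omega)
  obtain rfl : j = i + 2 * d := by omega
  exact thetaSum_add_thetaSum_add_two_mul_le hs hs1 i d

theorem thetaSum_add_thetaSum_lt (hs : 0 < s) (hs1 : s ≤ 1) {n i j : ℕ}
    (h : i + j + 1 = 2 * n) : thetaSum s i + thetaSum s j < 2 * thetaSum s n :=
  (add_lt_add_right (thetaSum_lt_succ hs j) _).trans_le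
    (thetaSum_add_thetaSum_le hs hs1 (by omega))

theorem le_pow_sq_mul {u : ℕ → ℝ} {M : ℕ} (hs : 0 < s) (hu : ∀ m ≤ M, 0 < u m)
    (h1 : 1 ≤ M → u 1 ≤ s * u 0)
    (hc : ∀ m, m + 2 ≤ M → u m * u (m + 2) ≤ s ^ 2 * u (m + 1) ^ 2) :
    ∀ m ≤ M, u m ≤ s ^ (m ^ 2) * u 0 := by
  have hstep : ∀ m, m + 1 ≤ M → u (m + 1) ≤ s ^ (2 * m + 1) * u m := by
    intro m
    induction m with
    | zero => simpa using h1
    | succ m ih =>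
      intro hm
      have hpos := hu (m + 1) (by omega)
      refine le_of_mul_le_mul_left ?_ (hu m (by omega))
      calc u m * u (m + 2) ≤ s ^ 2 * u (m + 1) ^ 2 := hc m hm
        _ = s ^ 2 * u (m + 1) * u (m + 1) := by ring
        _ ≤ s ^ 2 * u (m + 1) * (s ^ (2 * m + 1) * u m) := by gcongr; exact ih (by omega)
        _ = u m * (s ^ (2 * (m + 1) + 1) * u (m + 1)) := by ring
  intro m
  induction m with
  | zero => simp
  | succ m ih =>
    intro hm
    calc u (m + 1) ≤ s ^ (2 * m + 1) * u m := hstep m hm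
      _ ≤ s ^ (2 * m + 1) * (s ^ (m ^ 2) * u 0) := by gcongr; exact ih (by omega)
      _ = s ^ ((m + 1) ^ 2) * u 0 := by ring

/-- Nonnegative sequences supported on an initial interval and log-concave with a margin:
`u_{k+1}² ≥ s⁻² u_k u_{k+2}`. These are the moduli of the coefficients of the polynomials and power
series with second quotients of modulus at least `s⁻²`; the condition is stated without division,
so that a polynomial may be treated as a power series. -/
structure StronglyLogConcave (s : ℝ) (u : ℕ → ℝ) : Prop where
  nonneg : ∀ k, 0 ≤ u k
  pos_of_succ : ∀ k, 0 < u (k + 1) → 0 < u k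
  mul_le_sq : ∀ k, u k * u (k + 2) ≤ s ^ 2 * u (k + 1) ^ 2

/-- The term of index `j` exceeds its neighbours by a factor `s⁻¹`; for the sequence of moduli of
the terms `a_k z ^ k` of a power series, `j` plays the role of the central index at `z`. -/
def IsCentralIndex (s : ℝ) (u : ℕ → ℝ) (j : ℕ) : Prop :=
  (∀ i, i + 1 = j → u i ≤ s * u j) ∧ u (j + 1) ≤ s * u j

theorem isCentralIndex_mul_pow {u : ℕ → ℝ} {j : ℕ} {r : ℝ} (hr : 0 ≤ r)
    (hL : ∀ i, i + 1 = j → u i ≤ s * u j * r) (hR : u (j + 1) * r ≤ s * u j) :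
    IsCentralIndex s (fun k => u k * r ^ k) j := by
  refine ⟨?_, ?_⟩
  · rintro i rfl
    calc u i * r ^ i ≤ s * u (i + 1) * r * r ^ i := by gcongr; exact hL i rfl
      _ = s * (u (i + 1) * r ^ (i + 1)) := by ring
  · calc u (j + 1) * r ^ (j + 1) = u (j + 1) * r * r ^ j := by ring
      _ ≤ s * u j * r ^ j := mul_le_mul_of_nonneg_right hR (by positivity)
      _ = s * (u j * r ^ j) := by ring

namespace StronglyLogConcave

variable {u : ℕ → ℝ} {j : ℕ} {r : ℝ}

theorem pos_of_le (hu : StronglyLogConcave s u) {i : ℕ} (hij : i ≤ j) (hj : 0 < u j) :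
    0 < u i :=
  Nat.decreasingInduction (motive := fun k _ => 0 < u k) (fun k _ => hu.pos_of_succ k) hj hij

theorem mul_pow (hu : StronglyLogConcave s u) (hr : 0 < r) :
    StronglyLogConcave s fun k => u k * r ^ k where
  nonneg k := mul_nonneg (hu.nonneg k) (by positivity)
  pos_of_succ k hk := mul_pos (hu.pos_of_succ k (pos_of_mul_pos_left hk (by positivity)))
    (by positivity)
  mul_le_sq k := by
    calc u k * r ^ k * (u (k + 2) * r ^ (k + 2))
        = u k * u (k + 2) * r ^ (2 * (k + 1)) := by ring
      _ ≤ s ^ 2 * u (k + 1) ^ 2 * r ^ (2 * (k + 1)) := 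
          mul_le_mul_of_nonneg_right (hu.mul_le_sq k) (by positivity)
      _ = s ^ 2 * (u (k + 1) * r ^ (k + 1)) ^ 2 := by ring

theorem add_le (hu : StronglyLogConcave s u) (hs : 0 < s) (hj : 0 < u j)
    (hR : u (j + 1) ≤ s * u j) (m : ℕ) : u (j + m) ≤ s ^ (m ^ 2) * u j := by
  rcases (hu.nonneg (j + m)).eq_or_lt with hzero | hpos
  · rw [← hzero]
    positivity
  · exact le_pow_sq_mul (u := fun i => u (j + i)) hs (fun i hi => hu.pos_of_le (by omega) hpos)
      (fun _ => hR) (fun i _ => hu.mul_le_sq (j + i)) m le_rfl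

theorem sub_le (hu : StronglyLogConcave s u) (hs : 0 < s) (hj : 0 < u j)
    (hL : ∀ i, i + 1 = j → u i ≤ s * u j) {m : ℕ} (hm : m ≤ j) :
    u (j - m) ≤ s ^ (m ^ 2) * u j := by
  refine le_pow_sq_mul (u := fun i => u (j - i)) hs (fun i _ => hu.pos_of_le (by omega) hj)
    (fun h => hL (j - 1) (by omega)) (fun i hi => ?_) m hm
  obtain ⟨k, rfl⟩ := Nat.exists_eq_add_of_le hi
  have hk := hu.mul_le_sq k
  rw [mul_comm]
  convert hk using 3 <;> congr 1 <;> omega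

theorem sum_range_le (hu : StronglyLogConcave s u) (hs : 0 < s) (hj : 0 < u j)
    (hL : ∀ i, i + 1 = j → u i ≤ s * u j) :
    ∑ k ∈ Finset.range j, u k ≤ thetaSum s j * u j := by
  rw [← Finset.sum_range_reflect, thetaSum, Finset.sum_mul]
  refine Finset.sum_le_sum fun m hm => ?_
  rw [Nat.sub_sub, add_comm 1]
  exact hu.sub_le hs hj hL (Finset.mem_range.1 hm)

theorem sum_range_add_le (hu : StronglyLogConcave s u) (hs : 0 < s) (hj : 0 < u j)
    (hR : u (j + 1) ≤ s * u j) (d : ℕ) :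
    ∑ m ∈ Finset.range d, u (j + 1 + m) ≤ thetaSum s d * u j := by
  rw [thetaSum, Finset.sum_mul]
  refine Finset.sum_le_sum fun m _ => ?_
  rw [add_assoc, add_comm 1]
  exact hu.add_le hs hj hR (m + 1)

theorem sum_le_of_thetaSum_le (hu : StronglyLogConcave s u) (hs : 0 < s) (hj : 0 < u j)
    (hc : IsCentralIndex s u j) {T : ℝ}
    (hT : ∀ d, 0 < u (j + d) → thetaSum s j + thetaSum s d ≤ T) (d : ℕ) :
    ∑ k ∈ Finset.range j, u k + ∑ m ∈ Finset.range d, u (j + 1 + m) ≤ T * u j := by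
  have hbound : ∀ d, 0 < u (j + d) →
      ∑ k ∈ Finset.range j, u k + ∑ m ∈ Finset.range d, u (j + 1 + m) ≤ T * u j := fun d hd =>
    calc _ ≤ thetaSum s j * u j + thetaSum s d * u j :=
          add_le_add (hu.sum_range_le hs hj hc.1) (hu.sum_range_add_le hs hj hc.2 d)
      _ ≤ T * u j := by rw [← add_mul]; gcongr; exact hT d hd
  induction d with
  | zero => exact hbound 0 hj
  | succ d ih =>
    rcases (hu.nonneg (j + (d + 1))).eq_or_lt with hzero | hpos
    · rwa [Finset.sum_range_succ, add_assoc j, add_comm 1, ← hzero, add_zero]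
    · exact hbound (d + 1) hpos

theorem norm_sub_lt {𝕜 : Type*} [NormedField 𝕜] {a : ℕ → 𝕜}
    (ha : StronglyLogConcave s (‖a ·‖)) (hs : 0 < s)
    (haj : a j ≠ 0) (hθ : ∃ T < 1, ∀ d, a (j + d) ≠ 0 → thetaSum s j + thetaSum s d ≤ T)
    {z w : 𝕜} (hz : z ≠ 0) (hw : HasSum (fun k => a k * z ^ k) w)
    (hc : IsCentralIndex s (fun k => ‖a k‖ * ‖z‖ ^ k) j) :
    ‖w - a j * z ^ j‖ < ‖a j * z ^ j‖ := by
  obtain ⟨T, hT1, hT⟩ := hθ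
  have hterm : ∀ k, ‖a k * z ^ k‖ = ‖a k‖ * ‖z‖ ^ k := fun k => by rw [norm_mul, norm_pow]
  have hu : StronglyLogConcave s fun k => ‖a k * z ^ k‖ := by
    simpa only [hterm] using ha.mul_pow (norm_pos_iff.2 hz)
  have hj : 0 < ‖a j * z ^ j‖ := norm_pos_iff.2 (mul_ne_zero haj (pow_ne_zero _ hz))
  simp only [← hterm] at hc
  have hpartial : ∀ d, ‖∑ k ∈ Finset.range (d + (j + 1)), a k * z ^ k - a j * z ^ j‖ ≤
      T * ‖a j * z ^ j‖ := by
    intro d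
    rw [add_comm d, Finset.sum_range_add, Finset.sum_range_succ, add_right_comm,
      add_sub_cancel_right]
    refine ((norm_add_le _ _).trans (add_le_add (norm_sum_le _ _) (norm_sum_le _ _))).trans ?_
    exact hu.sum_le_of_thetaSum_le hs hj hc
      (fun d hd => hT d (left_ne_zero_of_mul (norm_pos_iff.1 hd))) d
  have hlim := (((Filter.tendsto_add_atTop_iff_nat (j + 1)).2 hw.tendsto_sum_nat).sub_const
    (a j * z ^ j)).norm
  exact (le_of_tendsto' hlim hpartial).trans_lt (mul_lt_of_lt_one_left hj hT1)

theorem isCentralIndex_of_eq_mul_div (hu : StronglyLogConcave s u) (hs : 0 < s) (hj : 0 < u j)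
    (hj1 : 0 < u (j + 1)) : IsCentralIndex s (fun k => u k * (s * u j / u (j + 1)) ^ k) j := by
  refine isCentralIndex_mul_pow (by positivity) ?_ (mul_div_cancel₀ _ hj1.ne').le
  rintro i rfl
  rw [← mul_div_assoc, le_div_iff₀ hj1]
  exact (hu.mul_le_sq i).trans_eq (by ring)

theorem isCentralIndex_succ_of_eq_div_mul (hu : StronglyLogConcave s u) (hs : 0 < s)
    (hj : 0 < u j) (hj1 : 0 < u (j + 1)) :
    IsCentralIndex s (fun k => u k * (u j / (s * u (j + 1))) ^ k) (j + 1) := by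
  refine isCentralIndex_mul_pow (by positivity) ?_ ?_
  · rintro i hi
    obtain rfl : i = j := by omega
    rw [mul_div_cancel₀ _ (by positivity)]
  · rw [← mul_div_assoc, div_le_iff₀ (by positivity)]
    calc u (j + 1 + 1) * u j = u j * u (j + 2) := mul_comm _ _
      _ ≤ s ^ 2 * u (j + 1) ^ 2 := hu.mul_le_sq j
      _ = s * u (j + 1) * (s * u (j + 1)) := by ring

theorem exists_isCentralIndex_or (hu : StronglyLogConcave s u) (hs : 0 < s) (hs1 : s ≤ 1)
    (h0 : 0 < u 0) (hlim : Filter.Tendsto u Filter.atTop (nhds 0)) :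
    ∃ j, 0 < u j ∧
      (IsCentralIndex s u j ∨ (s * u j < u (j + 1) ∧ s * u (j + 1) < u j)) := by
  have hex : ∃ j, s * u (j + 1) < u j := by
    by_contra! hgrow
    have hmono : Monotone u := monotone_nat_of_le_succ fun j =>
      (hgrow j).trans (mul_le_of_le_one_left (hu.nonneg _) hs1)
    exact h0.not_ge (hmono.ge_of_tendsto hlim 0)
  classical
  have hlt := Nat.find_spec hex
  refine ⟨Nat.find hex, (mul_nonneg hs.le (hu.nonneg _)).trans_lt hlt, ?_⟩
  rcases le_or_gt (u (Nat.find hex + 1)) (s * u (Nat.find hex)) with hle | hgt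
  · exact Or.inl ⟨fun i hi => hi ▸ not_lt.1 (Nat.find_min hex (by omega)), hle⟩
  · exact Or.inr ⟨hgt, hlt⟩

theorem exists_isCentralIndex_mul_pow_or (hu : StronglyLogConcave s u) (hs : 0 < s) (hs1 : s ≤ 1)
    (h0 : 0 < u 0) (hr : 0 < r)
    (hlim : Filter.Tendsto (fun k => u k * r ^ k) Filter.atTop (nhds 0)) :
    ∃ j, 0 < u j ∧ (IsCentralIndex s (fun k => u k * r ^ k) j ∨
      (s * u j < u (j + 1) * r ∧ s * (u (j + 1) * r) < u j)) := by
  obtain ⟨j, hj, h⟩ := (hu.mul_pow hr).exists_isCentralIndex_or hs hs1 (by simpa using h0) hlim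
  have hpow : 0 < r ^ j := by positivity
  refine ⟨j, pos_of_mul_pos_left hj hpow.le, h.imp_right fun ⟨hlow, hhigh⟩ => ⟨?_, ?_⟩⟩ <;>
    refine lt_of_mul_lt_mul_right ?_ hpow.le
  · calc s * u j * r ^ j = s * (u j * r ^ j) := by ring
      _ < u (j + 1) * r ^ (j + 1) := hlow
      _ = u (j + 1) * r * r ^ j := by ring
  · calc s * (u (j + 1) * r) * r ^ j = s * (u (j + 1) * r ^ (j + 1)) := by ring
      _ < u j * r ^ j := hhigh

end StronglyLogConcave

end StronglyLogConcave

section Zeros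

open Metric

variable {s : ℝ} {a : ℕ → ℂ} {f : ℂ → ℂ}

theorem zeroCount_eq_of_isCentralIndex (ha : StronglyLogConcave s (‖a ·‖)) (hs : 0 < s)
    (hf : Differentiable ℂ f) (hsum : ∀ z, HasSum (fun k => a k * z ^ k) (f z)) {j : ℕ}
    (haj : a j ≠ 0) (hθ : ∃ T < 1, ∀ d, a (j + d) ≠ 0 → thetaSum s j + thetaSum s d ≤ T)
    {r : ℝ} (hr : 0 < r) (hc : IsCentralIndex s (fun k => ‖a k‖ * r ^ k) j) :
    zeroCount f 0 r = j := by
  rw [← zeroCount_const_mul_sub_pow hr haj]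
  refine zeroCount_eq_of_norm_sub_lt hr (fun z _ => hf.analyticAt z)
    (fun z _ => by fun_prop) fun z hz => ?_
  rw [mem_sphere_zero_iff_norm] at hz
  simp only [sub_zero]
  exact ha.norm_sub_lt hs haj hθ (norm_pos_iff.1 (hz ▸ hr)) (hsum z) (hz ▸ hc)

theorem exists_zeroCount_eq_add_one (ha : StronglyLogConcave s (‖a ·‖)) (hs : 0 < s)
    (hs1 : s ≤ 1) (ha0 : a 0 ≠ 0) (hf : Differentiable ℂ f)
    (hsum : ∀ z, HasSum (fun k => a k * z ^ k) (f z))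
    (hθ : ∀ j, a j ≠ 0 → ∃ T < 1, ∀ d, a (j + d) ≠ 0 → thetaSum s j + thetaSum s d ≤ T)
    {z : ℂ} (hz : z ≠ 0) (hfz : f z = 0) :
    ∃ r R, r < ‖z‖ ∧ ‖z‖ < R ∧ zeroCount f 0 R = zeroCount f 0 r + 1 := by
  have hz' : 0 < ‖z‖ := norm_pos_iff.2 hz
  have hlim : Filter.Tendsto (fun k => ‖a k‖ * ‖z‖ ^ k) Filter.atTop (nhds 0) := by
    simpa using (hsum z).summable.tendsto_atTop_zero.norm
  obtain ⟨j, hj, hc | ⟨hlow, hhigh⟩⟩ :=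
    ha.exists_isCentralIndex_mul_pow_or hs hs1 (norm_pos_iff.2 ha0) hz' hlim
  · have haj : a j ≠ 0 := norm_pos_iff.1 hj
    have hlt := ha.norm_sub_lt hs haj (hθ j haj) hz (hsum z) hc
    simp [hfz] at hlt
  have hj1 : 0 < ‖a (j + 1)‖ := pos_of_mul_pos_left ((mul_pos hs hj).trans hlow) hz'.le
  have haj : a j ≠ 0 := norm_pos_iff.1 hj
  have haj1 : a (j + 1) ≠ 0 := norm_pos_iff.1 hj1
  refine ⟨s * ‖a j‖ / ‖a (j + 1)‖, ‖a j‖ / (s * ‖a (j + 1)‖), ?_, ?_, ?_⟩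
  · rwa [div_lt_iff₀' hj1]
  · rwa [lt_div_iff₀' (by positivity), mul_assoc]
  · rw [zeroCount_eq_of_isCentralIndex ha hs hf hsum haj (hθ j haj)
        (by positivity) (ha.isCentralIndex_of_eq_mul_div hs hj hj1),
      zeroCount_eq_of_isCentralIndex ha hs hf hsum haj1 (hθ (j + 1) haj1)
        (by positivity) (ha.isCentralIndex_succ_of_eq_div_mul hs hj hj1)]
    push_cast
    rfl

theorem analyticOrderAt_eq_one_and_norm_ne (ha : StronglyLogConcave s (‖a ·‖)) (hs : 0 < s)
    (hs1 : s ≤ 1) (ha0 : a 0 ≠ 0) (hf : Differentiable ℂ f)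
    (hsum : ∀ z, HasSum (fun k => a k * z ^ k) (f z))
    (hθ : ∀ j, a j ≠ 0 → ∃ T < 1, ∀ d, a (j + d) ≠ 0 → thetaSum s j + thetaSum s d ≤ T) :
    (∀ z, f z = 0 → analyticOrderAt f z = 1) ∧
      ∀ z w, f z = 0 → f w = 0 → z ≠ w → ‖z‖ ≠ ‖w‖ := by
  have hf0 : f 0 ≠ 0 := by
    rwa [(hsum 0).unique (hasSum_single 0 fun k hk => by simp [hk]), pow_zero, mul_one]
  have hann : ∀ z : ℂ, f z = 0 → ∃ r R, 0 ≤ R ∧ r ≤ R ∧ zeroCount f 0 R = zeroCount f 0 r + 1 ∧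
      ∀ w : ℂ, ‖w‖ = ‖z‖ → w ∈ closedBall 0 R \ closedBall 0 r := by
    intro z hz
    obtain ⟨r, R, hr, hR, hcount⟩ := exists_zeroCount_eq_add_one ha hs hs1 ha0 hf hsum hθ
      (by rintro rfl; exact hf0 hz) hz
    refine ⟨r, R, (norm_nonneg z).trans hR.le, (hr.trans hR).le, hcount, fun w hw => ?_⟩
    simpa [hw] using ⟨hR.le, hr⟩
  refine ⟨fun z hz => ?_, fun z w hz hw hzw hnorm => hzw ?_⟩
  all_goals obtain ⟨r, R, hR, hrR, hcount, hmem⟩ := hann z hz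
  · exact analyticOrderAt_eq_one_of_zeroCount_eq_add_one hrR (fun z _ => hf.analyticAt z) hcount
      (mem_closedBall_self hR) hf0 (hmem z rfl) hz
  · exact eq_of_zeroCount_eq_add_one hrR (fun z _ => hf.analyticAt z) hcount
      (mem_closedBall_self hR) hf0 (hmem z rfl) hz (hmem w hnorm.symm) hw

theorem analyticOrderAt_eval_eq_rootMultiplicity {𝕜 : Type*} [NontriviallyNormedField 𝕜]
    {P : Polynomial 𝕜} (hP : P ≠ 0) (z : 𝕜) :
    analyticOrderAt (fun x => P.eval x) z = P.rootMultiplicity z := by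
  obtain ⟨Q, hQ, hdvd⟩ := P.exists_eq_pow_rootMultiplicity_mul_and_not_dvd hP z
  have heval : ∀ Q : Polynomial 𝕜, AnalyticAt 𝕜 (fun x => Q.eval x) z := fun Q =>
    AnalyticOnNhd.eval_polynomial Q z (Set.mem_univ z)
  rw [(heval P).analyticOrderAt_eq_natCast]
  refine ⟨fun x => Q.eval x, heval Q, fun h => hdvd (Polynomial.dvd_iff_isRoot.2 h),
    .of_forall fun x => ?_⟩
  conv_lhs => rw [hQ]
  simp

theorem hasSum_eval {R : Type*} [Semiring R] [TopologicalSpace R]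
    (P : Polynomial R) (z : R) : HasSum (fun k => P.coeff k * z ^ k) (P.eval z) := by
  rw [P.eval_eq_sum_range]
  refine hasSum_sum_of_ne_finset_zero fun k hk => ?_
  rw [P.coeff_eq_zero_of_natDegree_lt (by simpa using hk), zero_mul]

theorem stronglyLogConcave_norm_coeff {R : Type*} [NormedRing R] {P : Polynomial R}
    (ha : ∀ k ≤ P.natDegree, P.coeff k ≠ 0)
    (hq : ∀ k, k + 2 ≤ P.natDegree →
      ‖P.coeff k‖ * ‖P.coeff (k + 2)‖ ≤ s ^ 2 * ‖P.coeff (k + 1)‖ ^ 2) :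
    StronglyLogConcave s (‖P.coeff ·‖) where
  nonneg _ := norm_nonneg _
  pos_of_succ k hk := norm_pos_iff.2 <| ha k <|
    (Nat.le_succ k).trans (P.le_natDegree_of_ne_zero (norm_pos_iff.1 hk))
  mul_le_sq k := by
    by_cases hk : k + 2 ≤ P.natDegree
    · exact hq k hk
    · rw [P.coeff_eq_zero_of_natDegree_lt (not_le.1 hk), norm_zero, mul_zero]
      positivity

theorem rootMultiplicity_eq_one_and_norm_ne {P : Polynomial ℂ} (hs : 0 < s) (hs1 : s ≤ 1)
    (ha : ∀ k ≤ P.natDegree, P.coeff k ≠ 0)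
    (hq : ∀ k, k + 2 ≤ P.natDegree →
      ‖P.coeff k‖ * ‖P.coeff (k + 2)‖ ≤ s ^ 2 * ‖P.coeff (k + 1)‖ ^ 2)
    (hθ : ∀ i j, i + j = P.natDegree → thetaSum s i + thetaSum s j < 1) :
    (∀ z, P.IsRoot z → P.rootMultiplicity z = 1) ∧
      ∀ z w, P.IsRoot z → P.IsRoot w → z ≠ w → ‖z‖ ≠ ‖w‖ := by
  have hP : P ≠ 0 := fun h => ha 0 (Nat.zero_le _) (by rw [h, Polynomial.coeff_zero])
  have hθ' : ∀ j, P.coeff j ≠ 0 →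
      ∃ T < 1, ∀ d, P.coeff (j + d) ≠ 0 → thetaSum s j + thetaSum s d ≤ T := by
    intro j hj
    have hjN := P.le_natDegree_of_ne_zero hj
    refine ⟨_, hθ j (P.natDegree - j) (by omega), fun d hd => ?_⟩
    have hdN := P.le_natDegree_of_ne_zero hd
    gcongr
    exact thetaSum_mono hs (by omega)
  obtain ⟨hsimple, hnorm⟩ := analyticOrderAt_eq_one_and_norm_ne
    (stronglyLogConcave_norm_coeff ha hq) hs hs1 (ha 0 (Nat.zero_le _)) P.differentiable
    (hasSum_eval P) hθ'
  refine ⟨fun z hz => ?_, hnorm⟩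
  exact_mod_cast (analyticOrderAt_eval_eq_rootMultiplicity hP z).symm.trans (hsimple z hz)

end Zeros

section SecondQuotients

theorem thetaSum_rpow {c : ℝ} (hc : 0 < c) (n : ℕ) :
    thetaSum (c ^ (-(1 / 2) : ℝ)) n =
      ∑ k ∈ Finset.range n, c ^ (-((k : ℝ) + 1) ^ 2 / 2) := by
  refine Finset.sum_congr rfl fun m _ => ?_
  rw [← Real.rpow_natCast, ← Real.rpow_mul hc.le]
  congr 1
  push_cast
  ring

theorem mul_le_of_le_norm_secondQuotient {a : ℕ → ℂ} {c : ℝ} (hc : 0 < c) {k : ℕ} (h0 : a k ≠ 0)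
    (h2 : a (k + 2) ≠ 0) (h : c ≤ ‖secondQuotient a (k + 2)‖) :
    ‖a k‖ * ‖a (k + 2)‖ ≤ (c ^ (-(1 / 2) : ℝ)) ^ 2 * ‖a (k + 1)‖ ^ 2 := by
  have hs : (c ^ (-(1 / 2) : ℝ)) ^ 2 = c⁻¹ := by
    rw [← Real.rpow_natCast, ← Real.rpow_mul hc.le, ← Real.rpow_neg_one]
    norm_num
  have hpos : 0 < ‖a k‖ * ‖a (k + 2)‖ := mul_pos (norm_pos_iff.2 h0) (norm_pos_iff.2 h2)
  have hquot : ‖secondQuotient a (k + 2)‖ = ‖a (k + 1)‖ ^ 2 / (‖a k‖ * ‖a (k + 2)‖) := by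
    simp [secondQuotient]
  rw [hquot, le_div_iff₀ hpos] at h
  rwa [hs, inv_mul_eq_div, le_div_iff₀' hc]

theorem rootMultiplicity_eq_one_and_norm_ne_of_le_secondQuotient {P : Polynomial ℂ} {c : ℝ}
    (hc : 0 < c) (hc1 : c ^ (-(1 / 2) : ℝ) ≤ 1) (ha : ∀ k ≤ P.natDegree, P.coeff k ≠ 0)
    (hq : ∀ k, 2 ≤ k → k ≤ P.natDegree → c ≤ ‖secondQuotient P.coeff k‖)
    (hθ : ∀ i j, i + j = P.natDegree →
      thetaSum (c ^ (-(1 / 2) : ℝ)) i + thetaSum (c ^ (-(1 / 2) : ℝ)) j < 1) :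
    (∀ z, P.IsRoot z → P.rootMultiplicity z = 1) ∧
      ∀ z w, P.IsRoot z → P.IsRoot w → z ≠ w → ‖z‖ ≠ ‖w‖ :=
  rootMultiplicity_eq_one_and_norm_ne (Real.rpow_pos_of_pos hc _) hc1 ha
    (fun k hk => mul_le_of_le_norm_secondQuotient hc (ha k (by omega)) (ha (k + 2) hk)
      (hq (k + 2) (by omega) hk)) hθ

theorem two_mul_thetaSum_bEven {n : ℕ} (hn : 1 ≤ n) :
    2 * thetaSum (bEven n hn ^ (-(1 / 2) : ℝ)) n = 1 := by
  obtain ⟨hb, h⟩ := bEven_spec n hn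
  rw [thetaSum_rpow hb, ← sum_Icc_shift]
  linarith

theorem two_mul_thetaSum_lt_of_bEven_lt {n : ℕ} (hn : 1 ≤ n) {c : ℝ} (hc : bEven n hn < c) :
    2 * thetaSum (c ^ (-(1 / 2) : ℝ)) n < 1 := by
  have hb := (bEven_spec n hn).1
  refine lt_of_lt_of_eq ?_ (two_mul_thetaSum_bEven hn)
  rw [thetaSum_rpow hb, thetaSum_rpow (hb.trans hc)]
  exact mul_lt_mul_of_pos_left (Finset.sum_lt_sum_of_nonempty ⟨0, Finset.mem_range.2 hn⟩
    fun k _ => term_lt _ _ hb hc k) two_pos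

theorem thetaSum_bInfty_le (n : ℕ) : thetaSum (bInfty ^ (-(1 / 2) : ℝ)) n ≤ 1 / 2 := by
  obtain ⟨hb, hsum, h⟩ := bInfty_spec
  rw [thetaSum_rpow hb]
  have hle := hsum.sum_le_tsum (Finset.range n) fun k _ => Real.rpow_nonneg hb.le _
  linarith

theorem rootMultiplicity_eq_one_and_norm_ne_of_bEven_lt {n : ℕ} (hn : 1 ≤ n) {P : Polynomial ℂ}
    (hdeg : P.natDegree = 2 * n) (ha : ∀ k ≤ P.natDegree, P.coeff k ≠ 0)
    (hq : ∀ k, 2 ≤ k → k ≤ P.natDegree → bEven n hn < ‖secondQuotient P.coeff k‖) :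
    (∀ z, P.IsRoot z → P.rootMultiplicity z = 1) ∧
      ∀ z w, P.IsRoot z → P.IsRoot w → z ≠ w → ‖z‖ ≠ ‖w‖ := by
  obtain ⟨k₀, hk₀, hmin⟩ := (Finset.Icc 2 P.natDegree).exists_min_image
    (fun k => ‖secondQuotient P.coeff k‖) ⟨2, Finset.mem_Icc.2 ⟨le_rfl, by omega⟩⟩
  obtain ⟨h2k₀, hk₀N⟩ := Finset.mem_Icc.1 hk₀
  have hc := hq k₀ h2k₀ hk₀N
  have hcpos := (bEven_spec n hn).1.trans hc
  have hs := Real.rpow_pos_of_pos hcpos (-(1 / 2))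
  have hθ := two_mul_thetaSum_lt_of_bEven_lt hn hc
  have hs1 : ‖secondQuotient P.coeff k₀‖ ^ (-(1 / 2) : ℝ) ≤ 1 := by
    linarith [le_thetaSum hs hn]
  exact rootMultiplicity_eq_one_and_norm_ne_of_le_secondQuotient hcpos hs1 ha
    (fun k h2k hkN => hmin k (Finset.mem_Icc.2 ⟨h2k, hkN⟩))
    fun i j hij => (thetaSum_add_thetaSum_le hs hs1 (hij.trans hdeg)).trans_lt hθ

theorem rootMultiplicity_eq_one_and_norm_ne_of_bEven_le {n : ℕ} (hn : 1 ≤ n) {P : Polynomial ℂ}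
    (hdeg : P.natDegree + 1 = 2 * n) (ha : ∀ k ≤ P.natDegree, P.coeff k ≠ 0)
    (hq : ∀ k, 2 ≤ k → k ≤ P.natDegree → bEven n hn ≤ ‖secondQuotient P.coeff k‖) :
    (∀ z, P.IsRoot z → P.rootMultiplicity z = 1) ∧
      ∀ z w, P.IsRoot z → P.IsRoot w → z ≠ w → ‖z‖ ≠ ‖w‖ := by
  have hb := (bEven_spec n hn).1
  have hs := Real.rpow_pos_of_pos hb (-(1 / 2))
  have hθ := two_mul_thetaSum_bEven hn
  have hs1 : bEven n hn ^ (-(1 / 2) : ℝ) ≤ 1 := by linarith [le_thetaSum hs hn]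
  exact rootMultiplicity_eq_one_and_norm_ne_of_le_secondQuotient hb hs1 ha hq fun i j hij =>
    (thetaSum_add_thetaSum_lt hs hs1 (by omega)).trans_eq hθ

theorem analyticOrderAt_eq_one_and_norm_ne_of_bInfty_le {f : ℂ → ℂ} {a : ℕ → ℂ}
    (hf : Differentiable ℂ f) (hsum : ∀ z, HasSum (fun k => a k * z ^ k) (f z))
    (ha : ∀ k, a k ≠ 0) (hq : ∀ k, 2 ≤ k → bInfty ≤ ‖secondQuotient a k‖) :
    (∀ z, f z = 0 → analyticOrderAt f z = 1) ∧
      ∀ z w, f z = 0 → f w = 0 → z ≠ w → ‖z‖ ≠ ‖w‖ := by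
  have hb := bInfty_spec.1
  have hs := Real.rpow_pos_of_pos hb (-(1 / 2))
  have hs1 : bInfty ^ (-(1 / 2) : ℝ) ≤ 1 := by
    linarith [le_thetaSum hs le_rfl, thetaSum_bInfty_le 1]
  have hconc : StronglyLogConcave (bInfty ^ (-(1 / 2) : ℝ)) (‖a ·‖) :=
    { nonneg := fun _ => norm_nonneg _
      pos_of_succ := fun k _ => norm_pos_iff.2 (ha k)
      mul_le_sq := fun k =>
        mul_le_of_le_norm_secondQuotient hb (ha k) (ha (k + 2)) (hq (k + 2) (by omega)) }
  refine analyticOrderAt_eq_one_and_norm_ne hconc hs hs1 (ha 0) hf hsum fun j _ =>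
    ⟨thetaSum (bInfty ^ (-(1 / 2) : ℝ)) j + 1 / 2, ?_, fun d _ => ?_⟩
  · linarith [thetaSum_lt_succ hs j, thetaSum_bInfty_le (j + 1)]
  · gcongr
    exact thetaSum_bInfty_le d

end SecondQuotients

theorem theorem1 :
    -- (i) polynomials of even degree `2n`
    (∀ (n : ℕ) (hn : 1 ≤ n) (P : Polynomial ℂ), P.natDegree = 2 * n →
      (∀ k ≤ 2 * n, P.coeff k ≠ 0) →
      (∀ k, 2 ≤ k → k ≤ 2 * n → bEven n hn < ‖secondQuotient P.coeff k‖) →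
      (∀ z : ℂ, P.IsRoot z → P.rootMultiplicity z = 1) ∧
      (∀ z w : ℂ, P.IsRoot z → P.IsRoot w → z ≠ w → ‖z‖ ≠ ‖w‖)) ∧
    -- (ii) polynomials of odd degree `2n + 1`
    (∀ (n : ℕ) (_ : 1 ≤ n) (P : Polynomial ℂ), P.natDegree = 2 * n + 1 →
      (∀ k ≤ 2 * n + 1, P.coeff k ≠ 0) →
      (∀ k, 2 ≤ k → k ≤ 2 * n + 1 →
        bEven (n + 1) (Nat.le_add_left 1 n) ≤ ‖secondQuotient P.coeff k‖) →
      (∀ z : ℂ, P.IsRoot z → P.rootMultiplicity z = 1) ∧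
      (∀ z w : ℂ, P.IsRoot z → P.IsRoot w → z ≠ w → ‖z‖ ≠ ‖w‖)) ∧
    -- (iii) entire functions
    (∀ (f : ℂ → ℂ) (a : ℕ → ℂ), Differentiable ℂ f →
      (∀ z : ℂ, HasSum (fun k => a k * z ^ k) (f z)) →
      (∀ k, a k ≠ 0) →
      (∀ k, 2 ≤ k → bInfty ≤ ‖secondQuotient a k‖) →
      (∀ z : ℂ, f z = 0 → analyticOrderAt f z = 1) ∧
      (∀ z w : ℂ, f z = 0 → f w = 0 → z ≠ w → ‖z‖ ≠ ‖w‖)) := by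
  refine ⟨fun n hn P hdeg ha hq => ?_, fun n _ P hdeg ha hq => ?_, fun f a hf hsum ha hq =>
    analyticOrderAt_eq_one_and_norm_ne_of_bInfty_le hf hsum ha hq⟩
  · rw [← hdeg] at ha
    exact rootMultiplicity_eq_one_and_norm_ne_of_bEven_lt hn hdeg ha (hdeg ▸ hq)
  · rw [← hdeg] at ha
    exact rootMultiplicity_eq_one_and_norm_ne_of_bEven_le (Nat.le_add_left 1 n) (by omega) ha
      (hdeg ▸ hq)
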